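/- For a convex function $f:(0,\infty)\to\mathbb R$ with $f(1)=0$, put $f(0):=\lim_{x\downarrow 0}f(x)$ and $f'(\infty):=\lim_{x\uparrow\infty}f(x)/x$, both in $(-\infty,+\infty]$. For probability measures $P,Q$ on a measurable space, with densities $p,q$ with respect to a common dominating measure (for example $P+Q$), the $f$-divergence is $$D_f(P\|Q):=\int_{\{q>0\}} f\!\left(\frac pq\right)dQ+f'(\infty)\,P\{q=0\}\in[0,+\infty],$$ with the convention $\infty\cdot 0=0$. The divergence $D_f$ is called finite if $\sup_{P,Q}D_f(P\|Q)<\infty$, the supremum being over all pairs of probability measures on all measurable spaces. Let $m$ be a non-negative integer, let $f,f_1,\dots,f_m:(0,\infty)\to\mathbb R$ be convex functions vanishing at $1$, and let $D_1,\dots,D_m\ge 0$ be real numbers. Define $$A(D_1,\dots,D_m):=\sup\{D_f(P\|Q): D_{f_i}(P\|Q)\le D_i\ \text{for all } i\},$$ $$B(D_1,\dots,D_m):=\inf\{D_f(P\|Q): D_{f_i}(P\|Q)\ge D_i\ \text{for all } i\},$$ where $(P,Q)$ ranges over all pairs of probability measures on a common, arbitrary measurable space, and for $n\ge 1$ let $A_n(D_1,\dots,D_m)$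 and $B_n(D_1,\dots,D_m)$ be the same supremum and infimum with $(P,Q)$ restricted to pairs of probability measures on the finite set $\{1,\dots,n\}$. All values are taken in $[0,+\infty]$, with $\inf\emptyset=+\infty$. Theorem. One has $$A(D_1,\dots,D_m)=A_{m+2}(D_1,\dots,D_m).$$ If moreover the divergences $D_{f_1},\dots,D_{f_m}$ are all finite ($D_f$ need not be), then $$B(D_1,\dots,D_m)=B_{m+2}(D_1,\dots,D_m).$$ -/

import Mathlib

open MeasureTheory Filter Topology

universe u

noncomputable section

/-- `f(0) := lim_{x ↓ 0} f(x)`, as an extended real number. For `f` convex on `(0, ∞)` the limit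
exists in `(-∞, +∞]`, so that the limsup used here (which needs no existence proof) equals it. -/
def valueAtZero (f : ℝ → ℝ) : EReal :=
  limsup (fun x : ℝ => (f x : EReal)) (𝓝[>] (0 : ℝ))

/-- `f'(∞) := lim_{x ↑ ∞} f(x)/x`, as an extended real number. For `f` convex on `(0, ∞)` the
limit exists in `(-∞, +∞]`, so that the limsup used here equals it. -/
def slopeAtInfinity (f : ℝ → ℝ) : EReal :=
  limsup (fun x : ℝ => ((f x / x : ℝ) : EReal)) atTop

/-- The function `f` on `(0, ∞)`, extended to `[0, ∞)` by `f(0) = lim_{x ↓ 0} f(x)`. The values of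
the total function `f : ℝ → ℝ` outside `(0, ∞)` are never used. -/
def extendToZero (f : ℝ → ℝ) (t : ℝ) : EReal :=
  if 0 < t then (f t : EReal) else valueAtZero f

/-- The integral of an extended-real-valued function, `∫ g⁺ dμ - ∫ g⁻ dμ`. It is the usual
extended integral whenever one of the two terms is finite; in the definition of an `f`-divergence
below the second one always is, since a convex `f` is bounded below by an affine function. -/
def extendedIntegral {Ω : Type u} [MeasurableSpace Ω] (μ : Measure Ω) (g : Ω → EReal) : EReal :=
  ((∫⁻ x, (g x).toENNReal ∂μ : ENNReal) : EReal) - ((∫⁻ x, (-g x).toENNReal ∂μ : ENNReal) : EReal)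

/-- The `f`-divergence
`D_f(P‖Q) = ∫_{q > 0} f(p/q) dQ + f'(∞) P{q = 0}`,
where `p` and `q` are the densities of `P` and `Q` with respect to the dominating
measure `P + Q`. (In `EReal`, `⊤ * 0 = 0`.) -/
def fDivergence (f : ℝ → ℝ) {Ω : Type u} [MeasurableSpace Ω] (P Q : Measure Ω) : EReal :=
  let p : Ω → ENNReal := P.rnDeriv (P + Q)
  let q : Ω → ENNReal := Q.rnDeriv (P + Q)
  extendedIntegral (Q.restrict {x | 0 < q x}) (fun x => extendToZero f (p x / q x).toReal)
    + slopeAtInfinity f * ((P {x | q x = 0} : ENNReal) : EReal)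

/-- `D_f` is a finite divergence: its supremum over all pairs of probability measures on all
measurable spaces is finite. -/
def IsFiniteDivergence (f : ℝ → ℝ) : Prop :=
  sSup {d : EReal | ∃ (Ω : Type u) (_ : MeasurableSpace Ω) (P Q : Measure Ω),
    IsProbabilityMeasure P ∧ IsProbabilityMeasure Q ∧ d = fDivergence f P Q} < ⊤

/-- `A(D₁, …, D_m)`: the supremum of `D_f(P‖Q)` subject to `D_{f_i}(P‖Q) ≤ D_i` for all `i`, over
all pairs of probability measures on all measurable spaces. -/
def supDivergence {m : ℕ} (f : ℝ → ℝ) (fs : Fin m → ℝ → ℝ) (D : Fin m → ℝ) : EReal :=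
  sSup {d : EReal | ∃ (Ω : Type u) (_ : MeasurableSpace Ω) (P Q : Measure Ω),
    IsProbabilityMeasure P ∧ IsProbabilityMeasure Q ∧
      (∀ i, fDivergence (fs i) P Q ≤ (D i : EReal)) ∧ d = fDivergence f P Q}

/-- `B(D₁, …, D_m)`: the infimum of `D_f(P‖Q)` subject to `D_{f_i}(P‖Q) ≥ D_i` for all `i`, over
all pairs of probability measures on all measurable spaces; it is `+∞` if no pair is feasible. -/
def infDivergence {m : ℕ} (f : ℝ → ℝ) (fs : Fin m → ℝ → ℝ) (D : Fin m → ℝ) : EReal :=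
  sInf {d : EReal | ∃ (Ω : Type u) (_ : MeasurableSpace Ω) (P Q : Measure Ω),
    IsProbabilityMeasure P ∧ IsProbabilityMeasure Q ∧
      (∀ i, (D i : EReal) ≤ fDivergence (fs i) P Q) ∧ d = fDivergence f P Q}

/-- `A_n(D₁, …, D_m)`: the same supremum, over pairs of probability measures on an `n`-point set
(with all subsets measurable). -/
def supDivergenceFin (n : ℕ) {m : ℕ} (f : ℝ → ℝ) (fs : Fin m → ℝ → ℝ) (D : Fin m → ℝ) : EReal :=
  sSup {d : EReal | ∃ P Q : Measure (Fin n),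
    IsProbabilityMeasure P ∧ IsProbabilityMeasure Q ∧
      (∀ i, fDivergence (fs i) P Q ≤ (D i : EReal)) ∧ d = fDivergence f P Q}

/-- `B_n(D₁, …, D_m)`: the same infimum, over pairs of probability measures on an `n`-point set
(with all subsets measurable). -/
def infDivergenceFin (n : ℕ) {m : ℕ} (f : ℝ → ℝ) (fs : Fin m → ℝ → ℝ) (D : Fin m → ℝ) : EReal :=
  sInf {d : EReal | ∃ P Q : Measure (Fin n),
    IsProbabilityMeasure P ∧ IsProbabilityMeasure Q ∧
      (∀ i, (D i : EReal) ≤ fDivergence (fs i) P Q) ∧ d = fDivergence f P Q}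

end

/-! Put `μ = P + Q` and `s = dP/dμ`, so that `dQ/dμ = 1 - s`. Every `f`-divergence is then linear in
`μ`: it equals `∫ φ_f(s) dμ`, where `φ_f` is the perspective `(1 - s) f(s / (1 - s))`, with endpoint
values `f(0)` and `f'(∞)` (`fDivergence_withDensity`). Conversely, a measure and a `[0, 1]`-valued
function `s` come from a pair of probability measures as soon as the total mass is `2` and `∫ s =
1`.

So after normalising `μ`, the `m` divergences and `∫ s` are `m + 1` moments of a probability
measure. The moments together with the objective form the mean of a vector-valued function, which
lies in the convex hull of its almost sure values (`integral_mem_convexHull`), so finitely many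
atoms suffice. Carathéodory in dimension `m + 2` would give `m + 3` atoms. Since the objective need
only not get worse, it is not a constraint in the reduction, and `m + 2` atoms remain
(`exists_weights_card_le`).

The moments must be finite. For `A` the constraints ensure this; for `B` the finiteness of the
`D_{f_i}` does. An infinite objective is truncated for `A` and trivial for `B`. -/

/-! ### Means and convex hulls in finite dimension -/

/-- A point outside a convex hull in finite dimension, which is the
mean of points of the set, admits a nonzero functional that is weakly maximal at it. -/
theorem exists_ne_zero_le_of_integral_notMem_convexHull {Ω E : Type*} [MeasurableSpace Ω]
    [NormedAddCommGroup E] [NormedSpace ℝ E] [FiniteDimensional ℝ E]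
    (μ : Measure Ω) [IsProbabilityMeasure μ] {g : Ω → E} (hg : Integrable g μ) {S : Set E}
    (hS : ∀ᵐ x ∂μ, g x ∈ S) (hx : ∫ x, g x ∂μ ∉ convexHull ℝ S) :
    ∃ L : E →L[ℝ] ℝ, L ≠ 0 ∧ ∀ y ∈ S, L y ≤ L (∫ x, g x ∂μ) := by
  obtain ⟨x₀, hx₀⟩ := hS.exists
  by_cases hi : (interior (convexHull ℝ S)).Nonempty
  · obtain ⟨L, hL, hle⟩ := geometric_hahn_banach_of_nonempty_interior_point
      (convex_convexHull ℝ S) (fun h => hx (interior_subset h)) hi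
    exact ⟨L, hL, fun y hy => hle y (subset_convexHull ℝ S hy)⟩
  -- Without interior the affine span is proper, and a nonzero functional vanishing on its direction
  -- is constant on `S`.
  · rw [interior_convexHull_nonempty_iff_affineSpan_eq_top] at hi
    have hdir : (affineSpan ℝ S).direction < ⊤ := by
      rw [lt_top_iff_ne_top]
      intro h
      exact hi ((AffineSubspace.direction_eq_top_iff_of_nonempty
        ⟨_, subset_affineSpan ℝ S hx₀⟩).1 h)
    obtain ⟨L, hL, hker⟩ := Submodule.exists_le_ker_of_lt_top _ hdir
    have hconst : ∀ y ∈ S, L y = L (g x₀) := by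
      intro y hy
      have : y -ᵥ g x₀ ∈ (affineSpan ℝ S).direction :=
        AffineSubspace.vsub_mem_direction (subset_affineSpan ℝ S hy) (subset_affineSpan ℝ S hx₀)
      have := hker this
      simpa [sub_eq_zero] using this
    refine ⟨LinearMap.toContinuousLinearMap L, ?_, fun y hy => ?_⟩
    · intro h
      exact hL (by ext y; simpa using DFunLike.congr_fun h y)
    · have h1 : ∫ x, LinearMap.toContinuousLinearMap L (g x) ∂μ = L (g x₀) := by
        rw [integral_congr_ae (g := fun _ => L (g x₀)) (by
          filter_upwards [hS] with x hx using hconst _ hx)]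
        simp
      rw [← ContinuousLinearMap.integral_comp_comm _ hg, h1]
      exact (hconst y hy).le

/-- In finite dimension the mean of an integrable function lies in the convex hull of any set that
contains almost all of its values; no closedness is needed. -/
theorem integral_mem_convexHull {Ω : Type*} [MeasurableSpace Ω]
    (μ : Measure Ω) [IsProbabilityMeasure μ] (n : ℕ) :
    ∀ {E : Type u} [NormedAddCommGroup E] [NormedSpace ℝ E] [FiniteDimensional ℝ E]
      (_ : Module.finrank ℝ E = n) {g : Ω → E} (_ : Integrable g μ) {S : Set E}
      (_ : ∀ᵐ x ∂μ, g x ∈ S), ∫ x, g x ∂μ ∈ convexHull ℝ S := by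
  induction n using Nat.strong_induction_on with
  | _ n ih =>
  intro E _ _ _ hn g hg S hS
  by_contra hx
  obtain ⟨L, hL, hle⟩ := exists_ne_zero_le_of_integral_notMem_convexHull μ hg hS hx
  set x := ∫ x, g x ∂μ with hxdef
  have hLg : Integrable (fun ω => L (g ω)) μ := L.integrable_comp hg
  have hLx : ∫ ω, L (g ω) ∂μ = L x := ContinuousLinearMap.integral_comp_comm _ hg
  -- The nonnegative function `L x - L (g ω)` has mean zero, so almost all values of `g` lie in the
  -- hyperplane `x + ker L`, where induction on the dimension applies.
  have hae : ∀ᵐ ω ∂μ, L (g ω) = L x := by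
    have h0 : (fun ω => L x - L (g ω)) =ᵐ[μ] 0 := by
      rw [← integral_eq_zero_iff_of_nonneg_ae]
      · rw [integral_sub (integrable_const _) hLg, hLx]; simp
      · filter_upwards [hS] with ω hω
        simpa using hle _ hω
      · exact (integrable_const _).sub hLg
    filter_upwards [h0] with ω hω
    have : L x - L (g ω) = 0 := hω
    linarith
  set K : Submodule ℝ E := LinearMap.ker L.toLinearMap with hK
  have hKtop : K ≠ ⊤ := by
    intro h
    apply hL
    ext y
    have : y ∈ K := h ▸ Submodule.mem_top
    simpa [hK] using this
  -- A projection onto `K` makes `g - x` a `K`-valued function everywhere, changing it only on a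
  -- null set.
  obtain ⟨p, hp⟩ := LinearMap.exists_leftInverse_of_injective K.subtype K.ker_subtype
  have hpK : ∀ v : K, p v = v := fun v => DFunLike.congr_fun hp v
  set p' : E →L[ℝ] K := LinearMap.toContinuousLinearMap p with hp'
  have hint : Integrable (fun ω => g ω - x) μ := hg.sub (integrable_const _)
  have hmem := ih (Module.finrank ℝ K) (hn ▸ Submodule.finrank_lt hKtop) (E := K) rfl
    (p'.integrable_comp hint) (S := {v : K | x + v ∈ S}) (by
      filter_upwards [hae, hS] with ω h1 h2
      have h3 : g ω - x ∈ K := by simp [hK, h1]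
      have h4 : p' (g ω - x) = ⟨g ω - x, h3⟩ := hpK ⟨_, h3⟩
      change x + ((p' (g ω - x) : K) : E) ∈ S
      rw [h4]
      simpa using h2)
  rw [ContinuousLinearMap.integral_comp_comm _ hint, integral_sub hg (integrable_const _)] at hmem
  simp only [integral_const, probReal_univ, one_smul, ← hxdef, sub_self, map_zero] at hmem
  have hconv : Convex ℝ {v : K | x + v ∈ convexHull ℝ S} := by
    intro a ha b hb s t hs ht hst
    have := convex_convexHull ℝ S ha hb hs ht hst
    have he : s • (x + (a : E)) + t • (x + (b : E)) = x + ((s • a + t • b : K) : E) := by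
      have : x = s • x + t • x := by rw [← add_smul, hst, one_smul]
      conv_rhs => rw [this]
      simp only [smul_add, Submodule.coe_add, Submodule.coe_smul]
      abel
    rwa [he] at this
  have h0 := convexHull_min (t := {v : K | x + v ∈ convexHull ℝ S})
    (fun v hv => subset_convexHull ℝ S hv) hconv hmem
  exact hx (by simpa using h0)

/-! ### Carathéodory reduction with an objective -/

/-- A signed relation among more than `card κ + 1` points that preserves the total mass and the
moments `a k`, and does not decrease the objective `c`. -/
theorem exists_signed_relation {α κ : Type*} [Fintype κ] (a : κ → α → ℝ) (c : α → ℝ)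
    (t : Finset α) (ht : Fintype.card κ + 1 < t.card) :
    ∃ v : t → ℝ, (∃ x, v x < 0) ∧ ∑ x, v x = 0 ∧ (∀ k, ∑ x, v x * a k x = 0) ∧
      0 ≤ ∑ x, v x * c x := by
  classical
  let F : (t → ℝ) →ₗ[ℝ] (Option κ → ℝ) :=
    { toFun := fun v o => o.elim (∑ x, v x) (fun k => ∑ x, v x * a k x)
      map_add' := by
        intro v w; ext o
        cases o <;> simp [Finset.sum_add_distrib, add_mul]
      map_smul' := by
        intro r v; ext o
        cases o <;> simp [Finset.mul_sum, mul_assoc] }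
  -- There are more than `card κ + 1` unknowns and only `card κ + 1` linear equations.
  have hker : LinearMap.ker F ≠ ⊥ := by
    apply LinearMap.ker_ne_bot_of_finrank_lt
    simpa using ht
  obtain ⟨v, hv, hv0⟩ := Submodule.exists_mem_ne_zero_of_ne_bot hker
  have hF : F v = 0 := hv
  have h1 : ∑ x, v x = 0 := congrFun hF none
  have h2 : ∀ k, ∑ x, v x * a k x = 0 := fun k => congrFun hF (some k)
  obtain ⟨y, hy⟩ : ∃ y, v y ≠ 0 := Function.ne_iff.1 hv0
  have hneg : ∃ x, v x < 0 := by
    by_contra! h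
    exact hy ((Finset.sum_eq_zero_iff_of_nonneg fun i _ => h i).1 h1 y (Finset.mem_univ _))
  have hpos : ∃ x, 0 < v x := by
    by_contra! h
    exact hy ((Finset.sum_eq_zero_iff_of_nonpos fun i _ => h i).1 h1 y (Finset.mem_univ _))
  -- The total being zero, `v` takes both signs, so its sign may be chosen to favour the objective.
  rcases le_total 0 (∑ x, v x * c x) with h | h
  · exact ⟨v, hneg, h1, h2, h⟩
  · refine ⟨-v, ?_, by simpa using h1, fun k => by simpa using h2 k, by simpa using h⟩
    obtain ⟨x, hx⟩ := hpos
    exact ⟨x, by simpa using hx⟩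

/-- Finite weights can be moved onto at most `card κ + 1` of their points, keeping the total mass
and the moments `a k`, without decreasing the objective `c`. -/
theorem exists_weights_card_le {α κ : Type*} [Fintype κ] (a : κ → α → ℝ) (c : α → ℝ) (n : ℕ) :
    ∀ (t : Finset α) (_ : t.card = n) (w : α → ℝ) (_ : ∀ x ∈ t, 0 ≤ w x),
      ∃ (t' : Finset α) (w' : α → ℝ), t' ⊆ t ∧ t'.card ≤ Fintype.card κ + 1 ∧
        (∀ x ∈ t', 0 ≤ w' x) ∧ ∑ x ∈ t', w' x = ∑ x ∈ t, w x ∧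
        (∀ k, ∑ x ∈ t', w' x * a k x = ∑ x ∈ t, w x * a k x) ∧
        ∑ x ∈ t, w x * c x ≤ ∑ x ∈ t', w' x * c x := by
  classical
  induction n with
  | zero =>
    intro t ht w hw
    exact ⟨t, w, subset_rfl, by omega, hw, rfl, fun _ => rfl, le_rfl⟩
  | succ n ih =>
    intro t ht w hw
    by_cases hcard : t.card ≤ Fintype.card κ + 1
    · exact ⟨t, w, subset_rfl, hcard, hw, rfl, fun _ => rfl, le_rfl⟩
    obtain ⟨v, ⟨x₁, hx₁⟩, hv1, hva, hvc⟩ := exists_signed_relation a c t (by omega)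
    -- The minimal ratio is the largest step along `v` that keeps all weights nonnegative; it makes
    -- the weight at `x₀` vanish.
    obtain ⟨x₀, hx₀, hmin⟩ := Finset.exists_min_image
      (Finset.univ.filter fun x : t => v x < 0) (fun x => w x / (-v x))
      ⟨x₁, by simp [hx₁]⟩
    have hv₀ : v x₀ < 0 := by simpa using hx₀
    set ε := w x₀ / (-v x₀) with hε
    have hε0 : 0 ≤ ε := div_nonneg (hw _ x₀.2) (by linarith)
    let u : α → ℝ := fun x => if h : x ∈ t then w x + ε * v ⟨x, h⟩ else 0
    have hu : ∀ x : t, u x = w x + ε * v x := fun x => by simp [u]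
    have hu₀ : u x₀ = 0 := by
      rw [hu, hε, div_neg, neg_mul, div_mul_cancel₀ _ hv₀.ne, add_neg_cancel]
    have hsum : ∀ b : α → ℝ, ∑ x ∈ t.erase x₀, u x * b x
        = ∑ x ∈ t, w x * b x + ε * ∑ x : t, v x * b x := by
      intro b
      rw [Finset.sum_erase _ (by simp [hu₀]), ← Finset.sum_coe_sort t, ← Finset.sum_coe_sort t,
        Finset.mul_sum, ← Finset.sum_add_distrib]
      exact Finset.sum_congr rfl fun x _ => by rw [hu]; ring
    have hu0 : ∀ x ∈ t.erase x₀, 0 ≤ u x := by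
      intro x hx
      have hxt := Finset.mem_of_mem_erase hx
      rw [hu ⟨x, hxt⟩]
      rcases lt_or_ge (v ⟨x, hxt⟩) 0 with h | h
      · have := hmin ⟨x, hxt⟩ (by simp [h])
        rw [le_div_iff₀ (by linarith)] at this
        simp only [] at this ⊢
        linarith
      · have := hw x hxt
        positivity
    obtain ⟨t', w', hsub, hc', hw', h1, h2, h3⟩ := ih (t.erase x₀)
      (by rw [Finset.card_erase_of_mem x₀.2]; omega) u hu0
    refine ⟨t', w', hsub.trans (Finset.erase_subset _ _), hc', hw', ?_, fun k => ?_, ?_⟩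
    · have := hsum (fun _ => 1)
      simp only [mul_one, hv1, mul_zero, add_zero] at this
      rw [h1, this]
    · rw [h2, hsum, hva]; simp
    · refine le_trans ?_ h3
      rw [hsum]
      have := mul_nonneg hε0 hvc
      linarith

/-- The means of `card κ` integrable functions under a probability measure are attained by a
probability vector on `card κ + 1` points, with an objective that is at least as large. -/
theorem exists_finite_weights_integral {Ω κ : Type*} [MeasurableSpace Ω] [Fintype κ]
    (μ : Measure Ω) [IsProbabilityMeasure μ] {T : Set Ω} (hT : ∀ᵐ x ∂μ, x ∈ T)
    {a : κ → Ω → ℝ} (ha : ∀ k, Integrable (a k) μ) {c : Ω → ℝ} (hc : Integrable c μ)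
    {n : ℕ} (hn : Fintype.card κ + 1 ≤ n) :
    ∃ (x : Fin n → Ω) (w : Fin n → ℝ), (∀ j, x j ∈ T) ∧ (∀ j, 0 ≤ w j) ∧ ∑ j, w j = 1 ∧
      (∀ k, ∑ j, w j * a k (x j) = ∫ ω, a k ω ∂μ) ∧ ∫ ω, c ω ∂μ ≤ ∑ j, w j * c (x j) := by
  classical
  -- The objective enters as the coordinate `none`, so the first finite representation preserves it
  -- exactly.
  let g : Ω → Option κ → ℝ := fun ω o => o.elim (c ω) (fun k => a k ω)
  have hgo : ∀ o, Integrable (fun ω => g ω o) μ := by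
    rintro (_ | k)
    · exact hc
    · exact ha k
  have hg : Integrable g μ := Integrable.of_eval hgo
  have hmem := integral_mem_convexHull μ _ rfl hg (S := g '' T) (by
    filter_upwards [hT] with ω hω using ⟨ω, hω, rfl⟩)
  rw [convexHull_eq] at hmem
  obtain ⟨ι, s, w, z, hw0, hw1, hz, hsum⟩ := hmem
  obtain ⟨ω₀, -⟩ := hT.exists
  have : Nonempty Ω := ⟨ω₀⟩
  choose! y hyT hyz using hz
  rw [Finset.centerMass_eq_of_sum_1 _ _ hw1] at hsum
  have heval : ∀ o, ∑ i ∈ s, w i * g (y i) o = ∫ ω, g ω o ∂μ := by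
    intro o
    have h := congrFun hsum o
    rw [eval_integral hgo, Finset.sum_apply] at h
    rw [← h]
    exact Finset.sum_congr rfl fun i hi => by rw [hyz i hi]; rfl
  obtain ⟨t, w', hts, hcard, hw', h1, h2, h3⟩ := exists_weights_card_le
    (fun k i => a k (y i)) (fun i => c (y i)) _ s rfl w hw0
  have hne : t.Nonempty := by
    rw [Finset.nonempty_iff_ne_empty]
    rintro rfl
    rw [hw1] at h1
    simp at h1
  obtain ⟨i₀, hi₀⟩ := hne
  obtain ⟨e⟩ : Nonempty (t ↪ Fin n) :=
    Function.Embedding.nonempty_of_card_le (by simpa using hcard.trans hn)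
  -- Unused indices get weight zero and repeat a point of `T`, so that membership in `T` holds at
  -- all indices.
  let X : Fin n → Ω := Function.extend e (fun i => y i) (fun _ => y i₀)
  let W : Fin n → ℝ := Function.extend e (fun i => w' i) 0
  have hX : ∀ i, X (e i) = y i := fun i => e.injective.extend_apply _ _ _
  have hW : ∀ i, W (e i) = w' i := fun i => e.injective.extend_apply _ _ _
  have hW0 : ∀ j, j ∉ Set.range e → W j = 0 := fun j hj =>
    Function.extend_apply' _ _ _ (by simpa using hj)
  have hsumW : ∀ b : Ω → ℝ, ∑ j, W j * b (X j) = ∑ i ∈ t, w' i * b (y i) := by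
    intro b
    rw [← Finset.sum_coe_sort t]
    refine (Fintype.sum_of_injective e e.injective _ _ (fun j hj => by simp [hW0 j hj]) ?_).symm
    intro i
    rw [hX, hW]
  refine ⟨X, W, fun j => ?_, fun j => ?_, ?_, fun k => ?_, ?_⟩
  · by_cases hj : j ∈ Set.range e
    · obtain ⟨i, rfl⟩ := hj
      rw [hX]; exact hyT _ (hts i.2)
    · have : X j = y i₀ := Function.extend_apply' _ _ _ (by simpa using hj)
      rw [this]; exact hyT _ (hts hi₀)
  · by_cases hj : j ∈ Set.range e
    · obtain ⟨i, rfl⟩ := hj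
      rw [hW]; exact hw' _ i.2
    · rw [hW0 j hj]
  · have := hsumW (fun _ => 1)
    simp only [mul_one] at this
    rw [this, h1, hw1]
  · rw [hsumW (a k), h2 k]
    exact heval (some k)
  · rw [hsumW c]
    exact (heval none).symm.le.trans h3

/-! ### The perspective of a convex function -/

/-- The perspective `s ↦ (1 - s) f(s / (1 - s))` of `f` on `(0, 1)`, extended to the endpoints by
`f(0)` and `f'(∞)`. -/
noncomputable def perspective (f : ℝ → ℝ) (s : ℝ) : EReal :=
  if s ≤ 0 then valueAtZero f else if 1 ≤ s then slopeAtInfinity f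
  else (((1 - s) * f (s / (1 - s)) : ℝ) : EReal)

theorem perspective_of_nonpos (f : ℝ → ℝ) {s : ℝ} (hs : s ≤ 0) :
    perspective f s = valueAtZero f := if_pos hs

theorem perspective_of_one_le (f : ℝ → ℝ) {s : ℝ} (hs : 1 ≤ s) :
    perspective f s = slopeAtInfinity f := by
  rw [perspective, if_neg (by linarith), if_pos hs]

theorem perspective_of_mem (f : ℝ → ℝ) {s : ℝ} (h0 : 0 < s) (h1 : s < 1) :
    perspective f s = (((1 - s) * f (s / (1 - s)) : ℝ) : EReal) := by
  rw [perspective, if_neg (by linarith), if_neg (by linarith)]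

/-- A convex function vanishing at `1` is bounded below by a multiple of `-|x - 1|`. -/
theorem exists_lower_bound_of_convexOn {f : ℝ → ℝ} (hf : ConvexOn ℝ (Set.Ioi 0) f)
    (hf1 : f 1 = 0) : ∃ C : ℝ, 0 ≤ C ∧ ∀ x, 0 < x → -C * |x - 1| ≤ f x := by
  -- The chords from `1` to `2` and from `1/2` to `1` have slopes `f 2` and `-2 f(1/2)`; they bound
  -- `f` below on `x < 1` and `x > 1` respectively.
  refine ⟨max |f 2| (2 * |f (1 / 2)|), le_max_of_le_left (abs_nonneg _), fun x hx => ?_⟩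
  have h2 := neg_abs_le (f 2)
  have h2' := le_abs_self (f 2)
  have h3' := le_abs_self (f (1 / 2))
  have hm1 := le_max_left |f 2| (2 * |f (1 / 2)|)
  have hm2 := le_max_right |f 2| (2 * |f (1 / 2)|)
  rcases lt_trichotomy x 1 with h | rfl | h
  · have := hf.slope_mono_adjacent (x := x) (y := 1) (z := 2) hx (by simp) h (by norm_num)
    rw [hf1, div_le_div_iff₀ (by linarith) (by norm_num)] at this
    rw [abs_of_neg (sub_neg.2 h)]
    nlinarith
  · simp [hf1]
  · have := hf.slope_mono_adjacent (x := 1 / 2) (y := 1) (z := x) (by simp) hx (by norm_num) h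
    rw [hf1, div_le_div_iff₀ (by norm_num) (by linarith)] at this
    rw [abs_of_pos (sub_pos.2 h)]
    nlinarith

/-- Multiplying `-C |x - 1|` at `x = s / (1 - s)` by `1 - s` gives `-C |2s - 1| ≥ -C`; the endpoint
values inherit the bound as limits. Hence negative parts are always integrable. -/
theorem exists_le_perspective {f : ℝ → ℝ} (hf : ConvexOn ℝ (Set.Ioi 0) f) (hf1 : f 1 = 0) :
    ∃ C : ℝ, 0 ≤ C ∧ ∀ s, ((-C : ℝ) : EReal) ≤ perspective f s := by
  obtain ⟨C, hC, h⟩ := exists_lower_bound_of_convexOn hf hf1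
  refine ⟨C, hC, fun s => ?_⟩
  rcases le_or_gt s 0 with h0 | h0
  · rw [perspective_of_nonpos f h0, valueAtZero]
    refine le_limsup_of_frequently_le' (Eventually.frequently ?_)
    filter_upwards [Ioo_mem_nhdsGT (zero_lt_one' ℝ)] with x hx
    have := h x hx.1
    rw [abs_of_neg (by linarith [hx.2])] at this
    have hx0 := hx.1
    exact EReal.coe_le_coe_iff.2 (by nlinarith)
  rcases le_or_gt 1 s with h1 | h1
  · rw [perspective_of_one_le f h1, slopeAtInfinity]
    refine le_limsup_of_frequently_le' (Eventually.frequently ?_)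
    filter_upwards [eventually_gt_atTop (1 : ℝ)] with x hx
    have := h x (by linarith)
    rw [abs_of_pos (by linarith)] at this
    refine EReal.coe_le_coe_iff.2 ?_
    rw [le_div_iff₀ (by linarith)]
    linarith
  · rw [perspective_of_mem f h0 h1]
    have hs : 0 < 1 - s := by linarith
    have := h (s / (1 - s)) (div_pos h0 hs)
    refine EReal.coe_le_coe_iff.2 ?_
    have h4 : (1 - s) * |s / (1 - s) - 1| ≤ 1 := by
      rw [← abs_of_pos hs, ← abs_mul, abs_of_pos hs, mul_sub, mul_div_cancel₀ _ hs.ne', abs_le]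
      constructor <;> linarith
    have h5 := mul_le_mul_of_nonneg_left this hs.le
    nlinarith

/-- Convexity gives continuity on the open half-line only; elsewhere `f` is arbitrary and must be
cut off. -/
theorem measurable_piecewise_of_convexOn {f : ℝ → ℝ} (hf : ConvexOn ℝ (Set.Ioi 0) f) :
    Measurable (fun t : ℝ => if 0 < t then f t else 0) := by
  have hc : ContinuousOn f (Set.Ioi 0) := by
    have := hf.continuousOn_interior
    rwa [interior_Ioi] at this
  exact hc.measurable_piecewise (g := fun _ => (0 : ℝ)) continuousOn_const measurableSet_Ioi

theorem measurable_extendToZero {f : ℝ → ℝ} (hf : ConvexOn ℝ (Set.Ioi 0) f) :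
    Measurable (extendToZero f) := by
  have he : extendToZero f
      = fun t => if 0 < t then (((if 0 < t then f t else 0 : ℝ)) : EReal) else valueAtZero f := by
    ext t
    by_cases h : 0 < t <;> simp [extendToZero, h]
  rw [he]
  exact Measurable.ite measurableSet_Ioi
    (measurable_piecewise_of_convexOn hf).coe_real_ereal measurable_const

theorem measurable_perspective {f : ℝ → ℝ} (hf : ConvexOn ℝ (Set.Ioi 0) f) :
    Measurable (perspective f) := by
  have he : perspective f = fun s => if s ≤ 0 then valueAtZero f
      else if 1 ≤ s then slopeAtInfinity f
      else (((1 - s) * (fun t : ℝ => if 0 < t then f t else 0) (s / (1 - s)) : ℝ) : EReal) := by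
    ext s
    by_cases h0 : s ≤ 0
    · simp [perspective, h0]
    by_cases h1 : 1 ≤ s
    · simp [perspective, h0, h1]
    have : 0 < s / (1 - s) := div_pos (by linarith) (by linarith)
    simp [perspective, h0, h1, this]
  rw [he]
  refine Measurable.ite measurableSet_Iic measurable_const
    (Measurable.ite measurableSet_Ici measurable_const (Measurable.coe_real_ereal ?_))
  exact (measurable_const.sub measurable_id).mul ((measurable_piecewise_of_convexOn hf).comp
    (measurable_id.div (measurable_const.sub measurable_id)))

/-- Absorbs the singular term of an `f`-divergence into the positive and negative parts of one
integral; the hypotheses exclude `∞ - ∞`. -/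
theorem sub_add_mul_eq_of_ne_top {A B M : ENNReal} {σ : EReal} (hB : B ≠ ⊤) (hM : M ≠ ⊤)
    (hσ : σ ≠ ⊥) :
    ((A : EReal) - (B : EReal)) + σ * (M : EReal)
      = ((A + σ.toENNReal * M : ENNReal) : EReal) - ((B + (-σ).toENNReal * M : ENNReal) : EReal) := by
  induction σ with
  | bot => exact absurd rfl hσ
  | top =>
    rcases eq_or_ne M 0 with rfl | hM0
    · simp
    · have hMpos : (0 : EReal) < M := by
        simpa using pos_iff_ne_zero.2 hM0
      lift B to NNReal using hB
      rw [EReal.top_mul_of_pos hMpos]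
      simp only [EReal.toENNReal_top, ENNReal.top_mul hM0, add_top, EReal.coe_ennreal_top,
        EReal.neg_top, EReal.toENNReal_bot, zero_mul, add_zero]
      rw [EReal.add_top_of_ne_bot]
      · rw [EReal.top_sub]
        simp
      · intro h
        rw [sub_eq_add_neg, EReal.add_eq_bot_iff] at h
        rcases h with h | h
        · simp at h
        · rw [EReal.neg_eq_bot_iff] at h
          simp at h
  | coe r =>
    lift B to NNReal using hB
    lift M to NNReal using hM
    induction A with
    | top =>
      have h1 : (r : EReal) * ((M : ENNReal) : EReal) = ((r * M : ℝ) : EReal) := rfl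
      have h2 : (((B : ENNReal) + (-(r : EReal)).toENNReal * (M : ENNReal) : ENNReal)) ≠ ⊤ := by
        refine ENNReal.add_ne_top.2 ⟨by simp, ENNReal.mul_ne_top ?_ (by simp)⟩
        rw [← EReal.coe_neg, EReal.real_coe_toENNReal]
        exact ENNReal.ofReal_ne_top
      generalize ((B : ENNReal) + (-(r : EReal)).toENNReal * (M : ENNReal) : ENNReal) = N at h2
      lift N to NNReal using h2
      rw [h1, top_add, EReal.coe_ennreal_top]
      rfl
    | coe A =>
      rw [← EReal.coe_neg, EReal.real_coe_toENNReal, EReal.real_coe_toENNReal]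
      have h3 : max r 0 - max (-r) 0 = r := by
        rcases le_total r 0 with h | h
        · rw [max_eq_right h, max_eq_left (by linarith)]; ring
        · rw [max_eq_left h, max_eq_right (by linarith)]; ring
      have e1 : (((A : ENNReal) + ENNReal.ofReal r * (M : ENNReal) : ENNReal) : EReal)
          = ((A + max r 0 * M : ℝ) : EReal) := rfl
      have e2 : (((B : ENNReal) + ENNReal.ofReal (-r) * (M : ENNReal) : ENNReal) : EReal)
          = ((B + max (-r) 0 * M : ℝ) : EReal) := rfl
      have e3 : ((A : ENNReal) : EReal) - ((B : ENNReal) : EReal) + (r : EReal) * ((M : ENNReal) : EReal)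
          = ((A - B + r * M : ℝ) : EReal) := rfl
      rw [e1, e2, e3, ← EReal.coe_sub]
      congr 1
      nth_rewrite 1 [← h3]
      ring

/-! ### Extended integrals of functions bounded below -/

section ExtendedIntegral

variable {Ω : Type u} [MeasurableSpace Ω] {μ : Measure Ω} {g : Ω → EReal} {C : ℝ}

theorem lintegral_neg_toENNReal_ne_top [IsFiniteMeasure μ] (hC : ∀ x, ((-C : ℝ) : EReal) ≤ g x) :
    ∫⁻ x, (-g x).toENNReal ∂μ ≠ ⊤ := by
  have hle : ∫⁻ x, (-g x).toENNReal ∂μ ≤ ∫⁻ _, ENNReal.ofReal C ∂μ := by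
    refine lintegral_mono fun x => ?_
    rw [← EReal.real_coe_toENNReal]
    refine EReal.toENNReal_le_toENNReal (EReal.neg_le.1 ?_)
    simpa using hC x
  refine ne_top_of_le_ne_top ?_ hle
  rw [lintegral_const]
  exact ENNReal.mul_ne_top ENNReal.ofReal_ne_top (measure_ne_top μ _)

theorem extendedIntegral_mono {g' : Ω → EReal} (h : ∀ x, g x ≤ g' x) :
    extendedIntegral μ g ≤ extendedIntegral μ g' := by
  refine EReal.sub_le_sub ?_ ?_
  · exact EReal.coe_ennreal_le_coe_ennreal_iff.2
      (lintegral_mono fun x => EReal.toENNReal_le_toENNReal (h x))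
  · exact EReal.coe_ennreal_le_coe_ennreal_iff.2
      (lintegral_mono fun x => EReal.toENNReal_le_toENNReal (EReal.neg_le_neg_iff.2 (h x)))

theorem extendedIntegral_congr_ae {g' : Ω → EReal} (h : g =ᵐ[μ] g') :
    extendedIntegral μ g = extendedIntegral μ g' := by
  unfold extendedIntegral
  have h1 : ∫⁻ x, (g x).toENNReal ∂μ = ∫⁻ x, (g' x).toENNReal ∂μ :=
    lintegral_congr_ae (h.mono fun x hx => by simp only [hx])
  have h2 : ∫⁻ x, (-g x).toENNReal ∂μ = ∫⁻ x, (-g' x).toENNReal ∂μ :=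
    lintegral_congr_ae (h.mono fun x hx => by simp only [hx])
  rw [h1, h2]

theorem extendedIntegral_coe {h : Ω → ℝ} (hh : Integrable h μ) :
    extendedIntegral μ (fun x => (h x : EReal)) = ((∫ x, h x ∂μ : ℝ) : EReal) := by
  have h1 : ∫⁻ x, ENNReal.ofReal (h x) ∂μ ≠ ⊤ := hh.lintegral_lt_top.ne
  have h2 : ∫⁻ x, ENNReal.ofReal (-h x) ∂μ ≠ ⊤ := hh.neg.lintegral_lt_top.ne
  rw [integral_eq_lintegral_pos_part_sub_lintegral_neg_part hh, EReal.coe_sub]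
  simp only [extendedIntegral, ← EReal.coe_neg, EReal.real_coe_toENNReal]
  rw [EReal.coe_ennreal_toReal h1, EReal.coe_ennreal_toReal h2]

theorem extendedIntegral_eq_integral_toReal (hbot : ∀ x, g x ≠ ⊥) (htop : ∀ᵐ x ∂μ, g x ≠ ⊤)
    (hint : Integrable (fun x => (g x).toReal) μ) :
    extendedIntegral μ g = ((∫ x, (g x).toReal ∂μ : ℝ) : EReal) := by
  rw [← extendedIntegral_coe hint]
  exact extendedIntegral_congr_ae (htop.mono fun x hx => (EReal.coe_toReal hx (hbot x)).symm)

theorem ae_ne_top_and_integrable_of_extendedIntegral_ne_top [IsFiniteMeasure μ]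
    (hg : Measurable g) (hC : ∀ x, ((-C : ℝ) : EReal) ≤ g x) (h : extendedIntegral μ g ≠ ⊤) :
    (∀ᵐ x ∂μ, g x ≠ ⊤) ∧ Integrable (fun x => (g x).toReal) μ := by
  have hneg := lintegral_neg_toENNReal_ne_top (μ := μ) hC
  have hpos : ∫⁻ x, (g x).toENNReal ∂μ ≠ ⊤ := by
    intro ht
    apply h
    rw [extendedIntegral, ht]
    generalize ∫⁻ x, (-g x).toENNReal ∂μ = N at hneg
    lift N to NNReal using hneg
    rfl
  have htop : ∀ᵐ x ∂μ, g x ≠ ⊤ := by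
    filter_upwards [ae_lt_top' hg.ereal_toENNReal.aemeasurable hpos] with x hx
    intro hx'
    simp [hx'] at hx
  refine ⟨htop, hg.ereal_toReal.aestronglyMeasurable, ?_⟩
  rw [HasFiniteIntegral]
  refine lt_of_le_of_lt (b := ∫⁻ x, ((g x).toENNReal + (-g x).toENNReal) ∂μ) ?_ ?_
  · refine lintegral_mono_ae (htop.mono fun x hx => ?_)
    have hb : g x ≠ ⊥ := ne_bot_of_le_ne_bot (EReal.coe_ne_bot _) (hC x)
    generalize g x = y at hx hb
    lift y to ℝ using ⟨hx, hb⟩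
    rw [← EReal.coe_neg, EReal.real_coe_toENNReal, EReal.real_coe_toENNReal, EReal.toReal_coe,
      Real.enorm_eq_ofReal_abs]
    rcases le_total 0 y with h | h
    · rw [abs_of_nonneg h]; exact le_self_add
    · rw [abs_of_nonpos h]; exact le_add_self
  · rw [lintegral_add_left hg.ereal_toENNReal]
    exact ENNReal.add_lt_top.2 ⟨hpos.lt_top, hneg.lt_top⟩

/-- Monotone convergence for the positive part; truncating at a level `k ≥ 0` leaves the negative
part, which is finite, unchanged. -/
theorem extendedIntegral_le_of_forall_min_le [IsFiniteMeasure μ]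
    (hg : Measurable g) (hC : ∀ x, ((-C : ℝ) : EReal) ≤ g x) {b : EReal}
    (h : ∀ k : ℕ, extendedIntegral μ (fun x => min (g x) ((k : ℝ) : EReal)) ≤ b) :
    extendedIntegral μ g ≤ b := by
  have hneg := lintegral_neg_toENNReal_ne_top (μ := μ) hC
  have hmin : ∀ (k : ℕ) x, (-min (g x) ((k : ℝ) : EReal)).toENNReal = (-g x).toENNReal := by
    intro k x
    rcases le_total (g x) ((k : ℝ) : EReal) with hk | hk
    · rw [min_eq_left hk]
    · have h0 : (0 : EReal) ≤ ((k : ℝ) : EReal) := EReal.coe_nonneg.2 k.cast_nonneg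
      rw [min_eq_right hk, EReal.toENNReal_of_nonpos, EReal.toENNReal_of_nonpos]
      · simpa using h0.trans hk
      · simp
  have hsup : ∫⁻ x, (g x).toENNReal ∂μ
      = ⨆ k : ℕ, ∫⁻ x, (min (g x) ((k : ℝ) : EReal)).toENNReal ∂μ := by
    rw [← lintegral_iSup (fun k => (hg.min measurable_const).ereal_toENNReal)]
    · refine lintegral_congr fun x => le_antisymm ?_ ?_
      · refine le_of_forall_lt fun a ha => ?_
        rw [lt_iSup_iff]
        have hat : a ≠ ⊤ := ha.ne_top
        obtain ⟨k, hk⟩ := exists_nat_gt a.toReal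
        refine ⟨k, ?_⟩
        rcases le_total (g x) ((k : ℝ) : EReal) with h' | h'
        · rwa [min_eq_left h']
        · rw [min_eq_right h', EReal.real_coe_toENNReal]
          exact (ENNReal.lt_ofReal_iff_toReal_lt hat).2 hk
      · exact iSup_le fun k => EReal.toENNReal_le_toENNReal (min_le_left _ _)
    · intro i j hij x
      exact EReal.toENNReal_le_toENNReal
        (min_le_min_left _ (EReal.coe_le_coe_iff.2 (Nat.cast_le.2 hij)))
  simp only [extendedIntegral, hmin] at h ⊢
  generalize ∫⁻ x, (-g x).toENNReal ∂μ = N at hneg h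
  lift N to NNReal using hneg
  have hle : ∀ (X : ENNReal), (X : EReal) - ((N : ENNReal) : EReal) ≤ b ↔
      (X : EReal) ≤ b + ((N : ENNReal) : EReal) := fun X =>
    EReal.sub_le_iff_le_add (Or.inl (by simp)) (Or.inl (by simp))
  simp only [hle] at h ⊢
  have hX : (0 : EReal) ≤ b + ((N : ENNReal) : EReal) :=
    (EReal.coe_ennreal_nonneg _).trans (h 0)
  rw [← EReal.coe_toENNReal hX, EReal.coe_ennreal_le_coe_ennreal_iff, hsup]
  refine iSup_le fun k => ?_
  have := EReal.toENNReal_le_toENNReal (h k)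
  rwa [EReal.toENNReal_coe] at this

end ExtendedIntegral

/-! ### Divergences as integrals of perspectives -/

theorem withDensity_add_withDensity_one_sub {Ω : Type u} [MeasurableSpace Ω] (μ : Measure Ω)
    {s : Ω → ℝ} (hs : Measurable s) (hs0 : ∀ x, 0 ≤ s x) (hs1 : ∀ x, s x ≤ 1) :
    (μ.withDensity fun x => ENNReal.ofReal (s x))
      + (μ.withDensity fun x => ENNReal.ofReal (1 - s x)) = μ := by
  rw [← withDensity_add_left hs.ennreal_ofReal]
  have : ((fun x => ENNReal.ofReal (s x)) + fun x => ENNReal.ofReal (1 - s x)) = 1 := by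
    ext x
    rw [Pi.add_apply, ← ENNReal.ofReal_add (hs0 x) (by linarith [hs1 x])]
    simp
  rw [this, withDensity_one]

/-- The part of an `f`-divergence where `q > 0`, as an integral against the dominating measure. -/
theorem setLIntegral_withDensity_one_sub {Ω : Type u} [MeasurableSpace Ω] (μ : Measure Ω)
    {s : Ω → ℝ} (hs : Measurable s) {p q : Ω → ENNReal}
    (hp : p =ᵐ[μ] fun x => ENNReal.ofReal (s x)) (hq : q =ᵐ[μ] fun x => ENNReal.ofReal (1 - s x))
    (hs0 : ∀ x, 0 ≤ s x) {F : ℝ → ENNReal} (hF : Measurable F) :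
    ∫⁻ x, F (p x / q x).toReal
        ∂((μ.withDensity fun x => ENNReal.ofReal (1 - s x)).restrict {x | 0 < q x})
      = ∫⁻ x in {x | s x < 1}, ENNReal.ofReal (1 - s x) * F (s x / (1 - s x)) ∂μ := by
  have hm : Measurable fun x => ENNReal.ofReal (1 - s x) :=
    (measurable_const.sub hs).ennreal_ofReal
  have hset : {x | 0 < q x} =ᵐ[μ] {x | s x < 1} := by
    filter_upwards [hq] with x hx
    apply propext
    change 0 < q x ↔ s x < 1
    rw [hx, ENNReal.ofReal_pos, sub_pos]
  have hmeas : MeasurableSet {x | s x < 1} := measurableSet_lt hs measurable_const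
  rw [Measure.restrict_congr_set (withDensity_absolutelyContinuous μ _ hset),
    restrict_withDensity hmeas]
  have hae : ∀ᵐ x ∂((μ.restrict {x | s x < 1}).withDensity fun x => ENNReal.ofReal (1 - s x)),
      F (p x / q x).toReal = F (s x / (1 - s x)) := by
    refine withDensity_absolutelyContinuous _ _ ?_
    filter_upwards [ae_restrict_of_ae hp, ae_restrict_of_ae hq, ae_restrict_mem hmeas]
      with x h1 h2 h3
    have h4 : 0 < 1 - s x := sub_pos.2 h3
    rw [h1, h2, ← ENNReal.ofReal_div_of_pos h4,
      ENNReal.toReal_ofReal (div_nonneg (hs0 x) h4.le)]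
  have hFm : Measurable fun x => F (s x / (1 - s x)) :=
    hF.comp (hs.div (measurable_const.sub hs))
  rw [lintegral_congr_ae hae, lintegral_withDensity_eq_lintegral_mul _ hm hFm]
  rfl

/-- If `P` and `Q` have densities `s` and `1 - s`, their `f`-divergence is the integral of the
perspective of `f`. -/
theorem fDivergence_withDensity {Ω : Type u} [MeasurableSpace Ω] (μ : Measure Ω)
    [IsFiniteMeasure μ] {s : Ω → ℝ} (hs : Measurable s) (hs0 : ∀ x, 0 ≤ s x)
    (hs1 : ∀ x, s x ≤ 1) {f : ℝ → ℝ} (hf : ConvexOn ℝ (Set.Ioi 0) f) (hf1 : f 1 = 0) :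
    fDivergence f (μ.withDensity fun x => ENNReal.ofReal (s x))
        (μ.withDensity fun x => ENNReal.ofReal (1 - s x))
      = extendedIntegral μ fun x => perspective f (s x) := by
  obtain ⟨C, -, hC⟩ := exists_le_perspective hf hf1
  have hmp : Measurable fun x => ENNReal.ofReal (s x) := hs.ennreal_ofReal
  have hmq : Measurable fun x => ENNReal.ofReal (1 - s x) :=
    (measurable_const.sub hs).ennreal_ofReal
  have hpers : Measurable fun x => perspective f (s x) := (measurable_perspective hf).comp hs
  have hmeas : MeasurableSet {x | s x < 1} := measurableSet_lt hs measurable_const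
  simp only [fDivergence, withDensity_add_withDensity_one_sub μ hs hs0 hs1]
  have hp := Measure.rnDeriv_withDensity μ hmp
  have hq := Measure.rnDeriv_withDensity μ hmq
  set p := (μ.withDensity fun x => ENNReal.ofReal (s x)).rnDeriv μ
  set q := (μ.withDensity fun x => ENNReal.ofReal (1 - s x)).rnDeriv μ
  -- Where `q = 0` one has `s = 1`, so `P` coincides with `μ` there.
  have hM : (μ.withDensity fun x => ENNReal.ofReal (s x)) {x | q x = 0}
      = μ {x | s x < 1}ᶜ := by
    have hset : {x | q x = 0} =ᵐ[μ] ({x | s x < 1}ᶜ : Set Ω) := by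
      filter_upwards [hq] with x hx
      apply propext
      change q x = 0 ↔ ¬ s x < 1
      rw [hx, ENNReal.ofReal_eq_zero, not_lt, sub_nonpos]
    rw [measure_congr (withDensity_absolutelyContinuous μ _ hset),
      withDensity_apply _ hmeas.compl, setLIntegral_congr_fun (g := fun _ => 1) hmeas.compl]
    · simp
    · intro x hx
      have : s x = 1 := le_antisymm (hs1 x) (not_lt.1 hx)
      simp [this]
  -- Taking `F` to be the identity or negation treats the positive and negative parts at once; all
  -- that matters is compatibility with positive scaling.
  have key : ∀ (F : EReal → EReal), Measurable F →
      (∀ (a b : ℝ), 0 < a → ENNReal.ofReal a * (F (b : EReal)).toENNReal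
        = (F ((a * b : ℝ) : EReal)).toENNReal) →
      ∫⁻ x, (F (perspective f (s x))).toENNReal ∂μ
      = ∫⁻ x, (F (extendToZero f (p x / q x).toReal)).toENNReal
          ∂((μ.withDensity fun x => ENNReal.ofReal (1 - s x)).restrict {x | 0 < q x})
        + (F (slopeAtInfinity f)).toENNReal * μ {x | s x < 1}ᶜ := by
    intro F hF hFmul
    rw [setLIntegral_withDensity_one_sub μ hs hp hq hs0
      (F := fun t => (F (extendToZero f t)).toENNReal)
      (hF.comp (measurable_extendToZero hf)).ereal_toENNReal,
      ← lintegral_add_compl _ hmeas]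
    congr 1
    · refine setLIntegral_congr_fun hmeas fun x hx => ?_
      have h1 : s x < 1 := hx
      rcases (hs0 x).eq_or_lt with h0 | h0
      · simp only [← h0, extendToZero]
        simp [perspective_of_nonpos]
      · have hpos : 0 < s x / (1 - s x) := div_pos h0 (by linarith)
        simp only [extendToZero, if_pos hpos, perspective_of_mem f h0 h1]
        exact (hFmul _ _ (by linarith)).symm
    · rw [setLIntegral_congr_fun (g := fun _ => (F (slopeAtInfinity f)).toENNReal) hmeas.compl]
      · simp
      · intro x hx
        simp only [perspective_of_one_le f (not_lt.1 hx)]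
  have hpos := key id measurable_id (fun a b ha => by
    rw [id, id, EReal.real_coe_toENNReal, EReal.real_coe_toENNReal, ENNReal.ofReal_mul ha.le])
  have hneg := key (fun y => -y) measurable_id.neg (fun a b ha => by
    rw [← EReal.coe_neg, ← EReal.coe_neg, EReal.real_coe_toENNReal, EReal.real_coe_toENNReal,
      ← mul_neg, ENNReal.ofReal_mul ha.le])
  have hfin := lintegral_neg_toENNReal_ne_top (μ := μ) fun x => hC (s x)
  simp only [id] at hpos
  rw [extendedIntegral, extendedIntegral, hM]
  rw [hneg] at hfin ⊢
  rw [hpos]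
  refine sub_add_mul_eq_of_ne_top (ENNReal.add_ne_top.1 hfin).1 (measure_ne_top μ _) ?_
  rw [← perspective_of_one_le f le_rfl]
  exact ne_bot_of_le_ne_bot (EReal.coe_ne_bot _) (hC 1)

/-- The two densities with respect to `P + Q` add up to `1` almost everywhere, so one function
encodes the pair. The minimum with `1` makes the bounds hold everywhere. -/
theorem exists_density_add {Ω : Type u} [MeasurableSpace Ω] (P Q : Measure Ω)
    [IsFiniteMeasure P] [IsFiniteMeasure Q] :
    ∃ s : Ω → ℝ, Measurable s ∧ (∀ x, 0 ≤ s x) ∧ (∀ x, s x ≤ 1) ∧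
      P = (P + Q).withDensity (fun x => ENNReal.ofReal (s x)) ∧
      Q = (P + Q).withDensity (fun x => ENNReal.ofReal (1 - s x)) := by
  have hsum : ∀ᵐ x ∂(P + Q), P.rnDeriv (P + Q) x + Q.rnDeriv (P + Q) x = 1 := by
    filter_upwards [Measure.rnDeriv_add P Q (P + Q), Measure.rnDeriv_self (P + Q)] with x h1 h2
    rw [h2] at h1
    exact h1.symm
  have hP : ∀ᵐ x ∂(P + Q),
      P.rnDeriv (P + Q) x = ENNReal.ofReal (min 1 (P.rnDeriv (P + Q) x).toReal) := by
    filter_upwards [hsum] with x hx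
    have hle : P.rnDeriv (P + Q) x ≤ 1 := hx ▸ le_self_add
    have hne : P.rnDeriv (P + Q) x ≠ ⊤ := ne_top_of_le_ne_top ENNReal.one_ne_top hle
    rw [min_eq_right (by simpa using ENNReal.toReal_mono ENNReal.one_ne_top hle),
      ENNReal.ofReal_toReal hne]
  refine ⟨fun x => min 1 (P.rnDeriv (P + Q) x).toReal,
    measurable_const.min (Measure.measurable_rnDeriv _ _).ennreal_toReal,
    fun x => le_min zero_le_one ENNReal.toReal_nonneg, fun x => min_le_left _ _, ?_, ?_⟩
  · rw [← withDensity_congr_ae hP, Measure.withDensity_rnDeriv_eq]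
    exact Measure.absolutelyContinuous_of_le (Measure.le_add_right le_rfl)
  · have hQ : ∀ᵐ x ∂(P + Q), Q.rnDeriv (P + Q) x
        = ENNReal.ofReal (1 - min 1 (P.rnDeriv (P + Q) x).toReal) := by
      filter_upwards [hsum, hP] with x hx hx'
      rw [ENNReal.ofReal_sub _ (le_min zero_le_one ENNReal.toReal_nonneg), ← hx',
        ENNReal.ofReal_one, ← hx, ENNReal.add_sub_cancel_left]
      rw [hx']
      exact ENNReal.ofReal_ne_top
    rw [← withDensity_congr_ae hQ, Measure.withDensity_rnDeriv_eq]
    exact Measure.absolutelyContinuous_of_le (Measure.le_add_left le_rfl)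

/-- A pair of probability measures may be transported to any universe. -/
theorem exists_ulift_measures {Ω : Type} [MeasurableSpace Ω] (P Q : Measure Ω)
    [IsProbabilityMeasure P] [IsProbabilityMeasure Q] :
    ∃ P' Q' : Measure (ULift.{u} Ω), IsProbabilityMeasure P' ∧ IsProbabilityMeasure Q' ∧
      ∀ f : ℝ → ℝ, ConvexOn ℝ (Set.Ioi 0) f → f 1 = 0 →
        fDivergence f P' Q' = fDivergence f P Q := by
  obtain ⟨s, hs, hs0, hs1, hP, hQ⟩ := exists_density_add P Q
  set μ := P + Q with hμ
  let e : ULift.{u} Ω ≃ᵐ Ω := MeasurableEquiv.ulift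
  have hmap : ∀ F : Ω → ENNReal, ∫⁻ x, F (e x) ∂(μ.map e.symm) = ∫⁻ x, F x ∂μ := by
    intro F
    rw [lintegral_map_equiv]
    simp
  have hse : Measurable fun x => s (e x) := hs.comp e.measurable
  have hfin : IsFiniteMeasure (μ.map e.symm) := inferInstance
  refine ⟨(μ.map e.symm).withDensity fun x => ENNReal.ofReal (s (e x)),
    (μ.map e.symm).withDensity fun x => ENNReal.ofReal (1 - s (e x)), ⟨?_⟩, ⟨?_⟩, ?_⟩
  · rw [withDensity_apply _ MeasurableSet.univ, Measure.restrict_univ,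
      hmap fun x => ENNReal.ofReal (s x), ← setLIntegral_univ,
      ← withDensity_apply _ MeasurableSet.univ, ← hP, measure_univ]
  · rw [withDensity_apply _ MeasurableSet.univ, Measure.restrict_univ,
      hmap fun x => ENNReal.ofReal (1 - s x), ← setLIntegral_univ,
      ← withDensity_apply _ MeasurableSet.univ, ← hQ, measure_univ]
  · intro f hf hf1
    rw [fDivergence_withDensity _ hse (fun x => hs0 _) (fun x => hs1 _) hf hf1]
    conv_rhs => rw [hP, hQ, fDivergence_withDensity _ hs hs0 hs1 hf hf1]
    rw [extendedIntegral, extendedIntegral, hmap fun x => (perspective f (s x)).toENNReal,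
      hmap fun x => (-perspective f (s x)).toENNReal]

theorem isProbabilityMeasure_withDensity_ofReal_iff {Ω : Type u} [MeasurableSpace Ω]
    {μ : Measure Ω} {s : Ω → ℝ} (hs : Integrable s μ) (hs0 : ∀ x, 0 ≤ s x) :
    IsProbabilityMeasure (μ.withDensity fun x => ENNReal.ofReal (s x)) ↔ ∫ x, s x ∂μ = 1 := by
  rw [isProbabilityMeasure_iff, withDensity_apply _ MeasurableSet.univ, Measure.restrict_univ,
    ← ofReal_integral_eq_lintegral_ofReal hs (ae_of_all _ hs0), ENNReal.ofReal_eq_one]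

/-! ### Reduction to `m + 2` points -/

/-- A pair of probability measures, given by a density, can be replaced by a pair on `m + 2` points
with the same values of `m` finite divergences, and an integral objective that is at least as
large; the density of the new pair takes almost sure values of the old one. -/
theorem exists_fin_density {Ω : Type u} [MeasurableSpace Ω] {μ : Measure Ω} [IsFiniteMeasure μ]
    {s : Ω → ℝ} (hs : Measurable s) (hs0 : ∀ x, 0 ≤ s x) (hs1 : ∀ x, s x ≤ 1)
    (hP : IsProbabilityMeasure (μ.withDensity fun x => ENNReal.ofReal (s x)))
    (hQ : IsProbabilityMeasure (μ.withDensity fun x => ENNReal.ofReal (1 - s x)))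
    {m : ℕ} {fs : Fin m → ℝ → ℝ} (hfs : ∀ i, ConvexOn ℝ (Set.Ioi 0) (fs i))
    (hfs1 : ∀ i, fs i 1 = 0)
    (hfin : ∀ i, extendedIntegral μ (fun x => perspective (fs i) (s x)) ≠ ⊤)
    {c : ℝ → ℝ} (hc : Integrable (fun x => c (s x)) μ) {U : Set ℝ} (hU : ∀ᵐ x ∂μ, s x ∈ U) :
    ∃ (μ' : Measure (Fin (m + 2))) (s' : Fin (m + 2) → ℝ), IsFiniteMeasure μ' ∧
      (∀ j, 0 ≤ s' j) ∧ (∀ j, s' j ≤ 1) ∧ (∀ j, s' j ∈ U) ∧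
      IsProbabilityMeasure (μ'.withDensity fun x => ENNReal.ofReal (s' x)) ∧
      IsProbabilityMeasure (μ'.withDensity fun x => ENNReal.ofReal (1 - s' x)) ∧
      (∀ i, extendedIntegral μ' (fun x => perspective (fs i) (s' x))
        = extendedIntegral μ (fun x => perspective (fs i) (s x))) ∧
      ∫ x, c (s x) ∂μ ≤ ∫ j, c (s' j) ∂μ' := by
  have hbot : ∀ i t, perspective (fs i) t ≠ ⊥ := fun i t => by
    obtain ⟨C, -, hC⟩ := exists_le_perspective (hfs i) (hfs1 i)
    exact ne_bot_of_le_ne_bot (EReal.coe_ne_bot _) (hC t)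
  have hreal : ∀ i, (∀ᵐ x ∂μ, perspective (fs i) (s x) ≠ ⊤) ∧
      Integrable (fun x => (perspective (fs i) (s x)).toReal) μ := fun i => by
    obtain ⟨C, -, hC⟩ := exists_le_perspective (hfs i) (hfs1 i)
    exact ae_ne_top_and_integrable_of_extendedIntegral_ne_top
      ((measurable_perspective (hfs i)).comp hs) (fun x => hC (s x)) (hfin i)
  have hsint : Integrable s μ :=
    Integrable.of_mem_Icc 0 1 hs.aemeasurable (ae_of_all _ fun x => ⟨hs0 x, hs1 x⟩)
  have hsI : ∫ x, s x ∂μ = 1 := (isProbabilityMeasure_withDensity_ofReal_iff hsint hs0).1 hP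
  have hμ : μ Set.univ = 2 := by
    rw [← withDensity_add_withDensity_one_sub μ hs hs0 hs1, Measure.add_apply, measure_univ,
      measure_univ, one_add_one_eq_two]
  -- As `μ` has mass `2`, it is halved to apply the reduction; the factor `2` returns in the atoms
  -- of `μ'`.
  have hν : IsProbabilityMeasure ((2⁻¹ : ENNReal) • μ) :=
    ⟨by rw [Measure.smul_apply, hμ, smul_eq_mul,
      ENNReal.inv_mul_cancel two_ne_zero ENNReal.ofNat_ne_top]⟩
  have hac : (2⁻¹ : ENNReal) • μ ≪ μ := Measure.smul_absolutelyContinuous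
  have h2 : (2⁻¹ : ENNReal) ≠ ⊤ := ENNReal.inv_ne_top.2 two_ne_zero
  have hint : ∀ h : Ω → ℝ, ∫ x, h x ∂((2⁻¹ : ENNReal) • μ) = 2⁻¹ * ∫ x, h x ∂μ := by
    intro h
    rw [integral_smul_measure]
    simp
  let a : Option (Fin m) → Ω → ℝ :=
    fun o x => o.elim (s x) (fun i => (perspective (fs i) (s x)).toReal)
  -- There are `m + 1` moments, hence `m + 2` atoms. The set `T` keeps the atoms where every
  -- perspective is finite, so that `toReal` loses nothing there.
  obtain ⟨x, w, hxT, hw0, hw1, hwa, hwc⟩ := exists_finite_weights_integral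
    ((2⁻¹ : ENNReal) • μ) (T := {x | s x ∈ U ∧ ∀ i, perspective (fs i) (s x) ≠ ⊤}) (a := a)
    (c := fun x => c (s x)) (n := m + 2)
    (hac.ae_le (hU.and (ae_all_iff.2 fun i => (hreal i).1)))
    (by
      rintro (_ | i)
      · exact hsint.smul_measure h2
      · exact (hreal i).2.smul_measure h2)
    (hc.smul_measure h2) (by simp)
  let μ' : Measure (Fin (m + 2)) := ∑ j, ENNReal.ofReal (2 * w j) • Measure.dirac j
  have hμ' : IsFiniteMeasure μ' := by
    refine ⟨?_⟩
    simp only [μ', Measure.finsetSum_apply, Measure.smul_apply, measure_univ, smul_eq_mul, mul_one]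
    exact ENNReal.sum_lt_top.2 fun _ _ => ENNReal.ofReal_lt_top
  have hint' : ∀ h : Fin (m + 2) → ℝ, ∫ j, h j ∂μ' = 2 * ∑ j, w j * h j := by
    intro h
    rw [integral_finsetSum_measure fun j _ => Integrable.of_finite.smul_measure
      ENNReal.ofReal_ne_top, Finset.mul_sum]
    refine Finset.sum_congr rfl fun j _ => ?_
    rw [integral_smul_measure, integral_dirac,
      ENNReal.toReal_ofReal (mul_nonneg zero_le_two (hw0 j)), smul_eq_mul, mul_assoc]
  have hmean : ∀ o, ∫ j, a o (x j) ∂μ' = ∫ x, a o x ∂μ := by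
    intro o
    rw [hint', hwa o, hint, ← mul_assoc, mul_inv_cancel₀ two_ne_zero, one_mul]
  have hs'I : ∫ j, s (x j) ∂μ' = 1 := (hmean none).trans hsI
  refine ⟨μ', fun j => s (x j), hμ', fun j => hs0 _, fun j => hs1 _, fun j => (hxT j).1,
    ?_, ?_, fun i => ?_, ?_⟩
  · exact (isProbabilityMeasure_withDensity_ofReal_iff Integrable.of_finite fun j => hs0 _).2 hs'I
  · refine (isProbabilityMeasure_withDensity_ofReal_iff (s := fun j => 1 - s (x j))
      Integrable.of_finite fun j => sub_nonneg.2 (hs1 _)).2 ?_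
    rw [integral_sub Integrable.of_finite Integrable.of_finite, hs'I, hint']
    simp only [mul_one, hw1]
    norm_num
  · rw [extendedIntegral_eq_integral_toReal (fun j => hbot i _)
      (ae_of_all _ fun j => (hxT j).2 i) Integrable.of_finite,
      extendedIntegral_eq_integral_toReal (fun x => hbot i _) (hreal i).1 (hreal i).2]
    exact congrArg _ (hmean (some i))
  · rw [hint', ← div_le_iff₀' zero_lt_two, div_eq_inv_mul, ← hint]
    exact hwc

/-- The objective may be infinite, so each truncation of its perspective is transferred separately;
on the finite set the truncated integral is at most the full divergence. -/
theorem supDivergence_le_supDivergenceFin {m : ℕ} {f : ℝ → ℝ} {fs : Fin m → ℝ → ℝ}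
    (hf : ConvexOn ℝ (Set.Ioi 0) f) (hf1 : f 1 = 0)
    (hfs : ∀ i, ConvexOn ℝ (Set.Ioi 0) (fs i)) (hfs1 : ∀ i, fs i 1 = 0) (D : Fin m → ℝ) :
    supDivergence.{u} f fs D ≤ supDivergenceFin (m + 2) f fs D := by
  refine sSup_le ?_
  rintro d ⟨Ω, _, P, Q, hPp, hQp, hfeas, rfl⟩
  obtain ⟨s, hs, hs0, hs1, hP, hQ⟩ := exists_density_add P Q
  have hμ : IsFiniteMeasure (P + Q) := inferInstance
  generalize P + Q = μ at hP hQ hμ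
  subst hP hQ
  obtain ⟨C, hC0, hC⟩ := exists_le_perspective hf hf1
  have hper : Measurable fun x => perspective f (s x) := (measurable_perspective hf).comp hs
  have hfeas' : ∀ i, extendedIntegral μ (fun x => perspective (fs i) (s x)) ≤ (D i : EReal) :=
    fun i => fDivergence_withDensity μ hs hs0 hs1 (hfs i) (hfs1 i) ▸ hfeas i
  rw [fDivergence_withDensity μ hs hs0 hs1 hf hf1]
  refine extendedIntegral_le_of_forall_min_le hper (fun x => hC (s x)) fun k => ?_
  let c : ℝ → ℝ := fun t => (min (perspective f t) ((k : ℝ) : EReal)).toReal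
  have hlow : ∀ t, ((-C : ℝ) : EReal) ≤ min (perspective f t) ((k : ℝ) : EReal) := fun t =>
    le_min (hC t) (EReal.coe_le_coe_iff.2 (by linarith [k.cast_nonneg (α := ℝ)]))
  have hc : ∀ t, ((c t : ℝ) : EReal) = min (perspective f t) ((k : ℝ) : EReal) := fun t =>
    EReal.coe_toReal (ne_top_of_le_ne_top (EReal.coe_ne_top _) (min_le_right _ _))
      (ne_bot_of_le_ne_bot (EReal.coe_ne_bot _) (hlow t))
  have hcint : Integrable (fun x => c (s x)) μ := by
    refine Integrable.of_mem_Icc (-C) k (hper.min measurable_const).ereal_toReal.aemeasurable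
      (ae_of_all _ fun x => ⟨?_, ?_⟩)
    · rw [← EReal.coe_le_coe_iff, hc]
      exact hlow _
    · rw [← EReal.coe_le_coe_iff, hc]
      exact min_le_right _ _
  obtain ⟨μ', s', _, h0, h1, -, hP', hQ', heq, hle⟩ := exists_fin_density hs hs0 hs1 hPp hQp hfs
    hfs1 (fun i => ((hfeas' i).trans_lt (EReal.coe_lt_top _)).ne) hcint (U := Set.univ)
    (ae_of_all _ fun _ => Set.mem_univ _)
  have hs' : Measurable s' := measurable_of_finite s'
  simp only [← hc]
  rw [extendedIntegral_coe hcint]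
  calc ((∫ x, c (s x) ∂μ : ℝ) : EReal) ≤ ((∫ j, c (s' j) ∂μ' : ℝ) : EReal) :=
        EReal.coe_le_coe_iff.2 hle
    _ = extendedIntegral μ' fun j => ((c (s' j) : ℝ) : EReal) :=
        (extendedIntegral_coe Integrable.of_finite).symm
    _ ≤ extendedIntegral μ' fun j => perspective f (s' j) :=
        extendedIntegral_mono fun j => (hc _).trans_le (min_le_left _ _)
    _ ≤ supDivergenceFin (m + 2) f fs D := by
        refine le_sSup ⟨_, _, hP', hQ', fun i => ?_,
          (fDivergence_withDensity μ' hs' h0 h1 hf hf1).symm⟩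
        rw [fDivergence_withDensity μ' hs' h0 h1 (hfs i) (hfs1 i), heq i]
        exact hfeas' i

/-- Only pairs with finite objective matter. The reduction is applied to the negated objective, and
the set `U` keeps the new atoms where the perspective of `f` is finite. -/
theorem infDivergenceFin_le_infDivergence {m : ℕ} {f : ℝ → ℝ} {fs : Fin m → ℝ → ℝ}
    (hf : ConvexOn ℝ (Set.Ioi 0) f) (hf1 : f 1 = 0)
    (hfs : ∀ i, ConvexOn ℝ (Set.Ioi 0) (fs i)) (hfs1 : ∀ i, fs i 1 = 0) (D : Fin m → ℝ)
    (hfin : ∀ i, IsFiniteDivergence.{u} (fs i)) :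
    infDivergenceFin (m + 2) f fs D ≤ infDivergence.{u} f fs D := by
  refine le_sInf ?_
  rintro d ⟨Ω, _, P, Q, hPp, hQp, hfeas, rfl⟩
  rcases eq_or_ne (fDivergence f P Q) ⊤ with htop | htop
  · exact htop ▸ le_top
  have hne : ∀ i, fDivergence (fs i) P Q ≠ ⊤ := fun i =>
    (lt_of_le_of_lt (le_sSup (by exact ⟨Ω, _, P, Q, hPp, hQp, rfl⟩)) (hfin i)).ne
  obtain ⟨s, hs, hs0, hs1, hP, hQ⟩ := exists_density_add P Q
  have hμ : IsFiniteMeasure (P + Q) := inferInstance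
  generalize P + Q = μ at hP hQ hμ
  subst hP hQ
  simp only [fDivergence_withDensity μ hs hs0 hs1 (hfs _) (hfs1 _)] at hne hfeas
  rw [fDivergence_withDensity μ hs hs0 hs1 hf hf1] at htop ⊢
  obtain ⟨C, hC0, hC⟩ := exists_le_perspective hf hf1
  have hbot : ∀ t, perspective f t ≠ ⊥ := fun t =>
    ne_bot_of_le_ne_bot (EReal.coe_ne_bot _) (hC t)
  obtain ⟨hae, hint⟩ := ae_ne_top_and_integrable_of_extendedIntegral_ne_top
    ((measurable_perspective hf).comp hs) (fun x => hC (s x)) htop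
  obtain ⟨μ', s', _, h0, h1, hU, hP', hQ', heq, hle⟩ := exists_fin_density hs hs0 hs1 hPp hQp hfs
    hfs1 hne (c := fun t => -(perspective f t).toReal) hint.neg
    (U := {t | perspective f t ≠ ⊤}) hae
  have hs' : Measurable s' := measurable_of_finite s'
  rw [integral_neg, integral_neg, neg_le_neg_iff] at hle
  calc infDivergenceFin (m + 2) f fs D ≤ extendedIntegral μ' fun j => perspective f (s' j) := by
        refine sInf_le ⟨_, _, hP', hQ', fun i => ?_,
          (fDivergence_withDensity μ' hs' h0 h1 hf hf1).symm⟩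
        rw [fDivergence_withDensity μ' hs' h0 h1 (hfs i) (hfs1 i), heq i]
        exact hfeas i
    _ = ((∫ j, (perspective f (s' j)).toReal ∂μ' : ℝ) : EReal) :=
        extendedIntegral_eq_integral_toReal (fun j => hbot _) (ae_of_all _ hU) Integrable.of_finite
    _ ≤ ((∫ x, (perspective f (s x)).toReal ∂μ : ℝ) : EReal) := EReal.coe_le_coe_iff.2 hle
    _ = extendedIntegral μ fun x => perspective f (s x) :=
        (extendedIntegral_eq_integral_toReal (fun x => hbot _) hae hint).symm

theorem theorem2p1 {m : ℕ} (f : ℝ → ℝ) (fs : Fin m → ℝ → ℝ)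
    (hf : ConvexOn ℝ (Set.Ioi 0) f) (hf1 : f 1 = 0)
    (hfs : ∀ i, ConvexOn ℝ (Set.Ioi 0) (fs i)) (hfs1 : ∀ i, fs i 1 = 0)
    (D : Fin m → ℝ) (hD : ∀ i, 0 ≤ D i) :
    supDivergence.{u} f fs D = supDivergenceFin (m + 2) f fs D ∧
      ((∀ i, IsFiniteDivergence.{u} (fs i)) →
        infDivergence.{u} f fs D = infDivergenceFin (m + 2) f fs D) := by
  refine ⟨le_antisymm (supDivergence_le_supDivergenceFin hf hf1 hfs hfs1 D) (sSup_le ?_),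
    fun hfin => le_antisymm (le_sInf ?_)
      (infDivergenceFin_le_infDivergence hf hf1 hfs hfs1 D hfin)⟩
  · rintro d ⟨P, Q, hP, hQ, hfeas, rfl⟩
    -- `Fin (m + 2)` lives in `Type`, whereas the general supremum ranges over spaces in `Type u`.
    obtain ⟨P', Q', hP', hQ', h⟩ := exists_ulift_measures.{u} P Q
    exact le_sSup ⟨_, _, P', Q', hP', hQ', fun i => (h _ (hfs i) (hfs1 i)).trans_le (hfeas i),
      (h f hf hf1).symm⟩
  · rintro d ⟨P, Q, hP, hQ, hfeas, rfl⟩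
    obtain ⟨P', Q', hP', hQ', h⟩ := exists_ulift_measures.{u} P Q
    exact sInf_le ⟨_, _, P', Q', hP', hQ',
      fun i => (hfeas i).trans_eq (h _ (hfs i) (hfs1 i)).symm, (h f hf hf1).symm⟩
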